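/- **Theorem 4.5 (bounds on $\lambda_3(T(G))$).** All graphs are finite, simple and undirected. For a graph $H$ with at least two vertices let $\lambda(H)$ be its edge-connectivity, i.e. the minimum, over pairs of distinct vertices $x,y$, of the maximum number of pairwise edge-disjoint $x$–$y$ paths, and let $\delta(H)$ be its minimum degree. For a set $S$ of at least two vertices of $H$, an $S$-tree is a subgraph of $H$ that is a tree whose vertex set contains $S$; let $\lambda(S)$ be the maximum number of pairwise edge-disjoint $S$-trees in $H$. If $H$ has at least three vertices, put $\lambda_3(H)=\min\{\lambda(S) : S\subseteq V(H),\ |S|=3\}$. The total graph $T(G)$ of $G$ has vertex set $V(G)\sqcup E(G)$; two vertices of $G$ are adjacent in $T(G)$ if they are adjacent in $G$, two distinct edges of $G$ are adjacent in $T(G)$ if they share an endpoint, and a vertex and an edge of $G$ are adjacent in $T(G)$ if they are incident. Let $G$ be a connected graph with at least two vertices. Then $$\lambda_3(T(G))\le 2\delta(G),$$ and, if $G$ has at least three vertices (so that $\lambda_3(G)$ is defined), $$\min\{2\lambda(G)-1,\ 2\lambda_3(G),\ \lambda_3(G)+2\}\le\lambda_3(T(G)).$$ -/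

import Mathlib

namespace SimpleGraph

/-- The total graph of `G`: its vertices are the vertices and the edges of `G`; two vertices (edges)
of `G` are adjacent in it when they are adjacent in `G` (share an endpoint), and a vertex is adjacent
to the edges incident with it. -/
def totalGraph {V : Type*} (G : SimpleGraph V) : SimpleGraph (V ⊕ G.edgeSet) where
  Adj
    | Sum.inl u, Sum.inl v => G.Adj u v
    | Sum.inr e, Sum.inr f => G.lineGraph.Adj e f
    | Sum.inl v, Sum.inr e => v ∈ (e : Sym2 V)
    | Sum.inr e, Sum.inl v => v ∈ (e : Sym2 V)
  symm := ⟨by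
    rintro (u | e) (v | f) h
    · exact SimpleGraph.Adj.symm (G := G) h
    · exact h
    · exact h
    · exact SimpleGraph.Adj.symm (G := G.lineGraph) h⟩
  loopless := ⟨by
    rintro (u | e) h
    · exact G.irrefl h
    · exact G.lineGraph.irrefl h⟩

/-- A subgraph `T` of `G` is a Steiner tree connecting `S` (an `S`-tree) if it is a tree whose
vertex set contains `S`. -/
def IsSteinerTree {V : Type*} (G : SimpleGraph V) (S : Set V) (T : G.Subgraph) : Prop :=
  T.coe.IsTree ∧ S ⊆ T.verts

/-- `G` contains `m` pairwise edge-disjoint Steiner trees connecting `S`. -/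
def HasEdgeDisjointSteinerTrees {V : Type*} (G : SimpleGraph V) (S : Set V) (m : ℕ) : Prop :=
  ∃ T : Fin m → G.Subgraph, (∀ i, G.IsSteinerTree S (T i)) ∧
    ∀ i j, i ≠ j → Disjoint (T i).edgeSet (T j).edgeSet

/-- The generalized local edge-connectivity `λ(S)`: the maximum number of pairwise edge-disjoint
Steiner trees connecting `S` (for finite `G` and `|S| ≥ 2`). -/
noncomputable def generalizedLocalEdgeConnectivity {V : Type*} (G : SimpleGraph V)
    (S : Set V) : ℕ :=
  sSup {m : ℕ | G.HasEdgeDisjointSteinerTrees S m}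

/-- The generalized `k`-edge-connectivity `λ_k(G)`: the minimum of `λ(S)` over all `k`-element sets
of vertices (for `2 ≤ k ≤ |V(G)|`). -/
noncomputable def generalizedEdgeConnectivity {V : Type*} (G : SimpleGraph V) (k : ℕ) : ℕ :=
  sInf {m : ℕ | ∃ S : Finset V, S.card = k ∧
    m = G.generalizedLocalEdgeConnectivity (S : Set V)}

/-- `G` contains `m` pairwise edge-disjoint paths connecting `x` and `y`. -/
def HasEdgeDisjointPaths {V : Type*} (G : SimpleGraph V) (x y : V) (m : ℕ) : Prop :=
  ∃ P : Fin m → G.Path x y,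
    ∀ i j, i ≠ j → List.Disjoint (P i : G.Walk x y).edges (P j : G.Walk x y).edges

/-- `λ_G(x, y)`: the maximum number of pairwise edge-disjoint paths connecting two distinct vertices
`x` and `y` (for finite `G`). -/
noncomputable def localEdgeConnectivity {V : Type*} (G : SimpleGraph V) (x y : V) : ℕ :=
  sSup {m : ℕ | G.HasEdgeDisjointPaths x y m}

/-- The edge-connectivity `λ(G)`: the minimum of `λ_G(x, y)` over all pairs of distinct vertices
(for finite `G` with at least two vertices). -/
noncomputable def edgeConnectivity {V : Type*} (G : SimpleGraph V) : ℕ :=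
  sInf {m : ℕ | ∃ x y : V, x ≠ y ∧ m = G.localEdgeConnectivity x y}

/-- The maximum defining `λ(S)` exists for finite `G` and `|S| ≥ 2`. -/
theorem bddAbove_hasEdgeDisjointSteinerTrees {V : Type*} [Finite V] (G : SimpleGraph V)
    (S : Set V) (hS : S.Nontrivial) : BddAbove {m : ℕ | G.HasEdgeDisjointSteinerTrees S m} := by
  refine ⟨Nat.card (Sym2 V), ?_⟩
  rintro m ⟨T, hT, hd⟩
  obtain ⟨x, hx, y, hy, hxy⟩ := hS
  have hne : ∀ i, ∃ e, e ∈ (T i).edgeSet := by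
    intro i
    have hc := (hT i).1.1
    have : Nontrivial (T i).verts :=
      ⟨⟨x, (hT i).2 hx⟩, ⟨y, (hT i).2 hy⟩, fun h => hxy (congrArg Subtype.val h)⟩
    obtain ⟨w, hw⟩ := hc.preconnected.exists_adj_of_nontrivial ⟨x, (hT i).2 hx⟩
    exact ⟨s(x, w), hw⟩
  choose e he using hne
  have hinj : Function.Injective e := by
    intro i j hij
    by_contra h
    exact Set.disjoint_left.1 (hd i j h) (he i) (hij ▸ he j)
  simpa using Nat.card_le_card_of_injective e hinj

/-- The maximum defining `λ_G(x, y)` exists for finite `G` and `x ≠ y`. -/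
theorem bddAbove_hasEdgeDisjointPaths {V : Type*} [Finite V] (G : SimpleGraph V)
    (x y : V) (hxy : x ≠ y) : BddAbove {m : ℕ | G.HasEdgeDisjointPaths x y m} := by
  refine ⟨Nat.card (Sym2 V), ?_⟩
  rintro m ⟨P, hd⟩
  have hne : ∀ i, ∃ e, e ∈ (P i : G.Walk x y).edges := by
    intro i
    apply List.exists_mem_of_ne_nil
    intro h
    exact hxy (Walk.edges_eq_nil.1 h).eq
  choose e he using hne
  have hinj : Function.Injective e := by
    intro i j hij
    by_contra h
    exact hd i j h (he i) (hij ▸ he j)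
  simpa using Nat.card_le_card_of_injective e hinj

end SimpleGraph

namespace SimpleGraph

/-! Upper bound: a vertex of minimum degree has at most 2δ(G) neighbours in T(G), and edge-disjoint
trees through it and two other vertices use different edges at it.

Lower bound: write m = λ₃(G) and n = λ(G). Trees may be relaxed to connecting subgraphs.
Edge-disjoint trees T₁, …, Tₘ of G through a triple of vertices can be used twice in T(G). Their
line graphs are vertex-disjoint and, once tied to the prescribed vertices and edges, give m members
(`isPacking_lineFamily`). Two of the trees themselves, in the copy of G, give two more when tied by
incidences to different ends of the prescribed edges (`exists_distinct_ends`). The total is m + 2,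
or m + 1 = 2m if m = 1.

If the three prescribed elements contain no incident pair, it suffices to represent each edge by one
of its ends (`exists_isPacking_of_not_incident`). One incident pair costs a detour in the last
member (`exists_isPacking_of_incident`). For an edge with both its ends there are n edge-disjoint
paths between the ends; at most one is lost to the edge itself, the others serve twice, and one
small extra tree makes 2(n - 1) + 1 (`exists_isPacking_of_both_ends`). For a vertex with two of its
edges, stars centred at the remaining edges of that vertex replace the line graphs
(`exists_isPacking_of_two_incident`), and the count uses that every degree is at least m and at
least n. -/

/-- The vertices in `S` all lie in one connected component of `K`. -/
def Connects {W : Type*} (K : SimpleGraph W) (S : Set W) : Prop :=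
  ∃ r, ∀ x ∈ S, K.Reachable r x

/-- A family of pairwise edge-disjoint spanning subgraphs of `H`, each of which connects `S`. -/
structure IsPacking {W ι : Type*} (H : SimpleGraph W) (S : Set W) (K : ι → SimpleGraph W) :
    Prop where
  le : ∀ i, K i ≤ H
  disj : ∀ i j, i ≠ j → ∀ x y, (K i).Adj x y → ¬ (K j).Adj x y
  conn : ∀ i, (K i).Connects S

/-! ### Packings by connecting subgraphs, and their relation to the connectivities -/

section Packing

variable {W ι κ : Type*} {H : SimpleGraph W} {S : Set W} {K : ι → SimpleGraph W}

lemma Connects.reachable {K : SimpleGraph W} (h : K.Connects S) {x y : W} (hx : x ∈ S)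
    (hy : y ∈ S) : K.Reachable x y := by
  obtain ⟨r, hr⟩ := h
  exact (hr x hx).symm.trans (hr y hy)

lemma IsPacking.comp (h : IsPacking H S K) (f : κ ↪ ι) : IsPacking H S (K ∘ f) where
  le _ := h.le _
  disj _ _ hij := h.disj _ _ (f.injective.ne hij)
  conn _ := h.conn _

lemma IsPacking.option (h : IsPacking H S K) {A : SimpleGraph W} (hA : A ≤ H)
    (hAS : A.Connects S) (hKA : ∀ i x y, (K i).Adj x y → ¬ A.Adj x y) :
    IsPacking H S (fun o : Option ι => o.elim A K) where
  le i := by cases i with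
    | none => exact hA
    | some i => exact h.le i
  disj i j hij := by
    rcases i with _ | i <;> rcases j with _ | j
    · exact absurd rfl hij
    · exact fun x y hx hy => hKA j x y hy hx
    · exact hKA i
    · exact h.disj i j fun e => hij (e ▸ rfl)
  conn i := by cases i with
    | none => exact hAS
    | some i => exact h.conn i

lemma IsPacking.sum (h : IsPacking H S K) {K' : κ → SimpleGraph W} (h' : IsPacking H S K')
    (hd : ∀ i j x y, (K i).Adj x y → ¬ (K' j).Adj x y) :
    IsPacking H S (Sum.elim K K') where
  le i := by cases i with
    | inl i => exact h.le i
    | inr i => exact h'.le i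
  disj i j hij := by
    rcases i with i | i <;> rcases j with j | j
    · exact h.disj i j fun e => hij (e ▸ rfl)
    · exact hd i j
    · exact fun x y hx hy => hd j i x y hy hx
    · exact h'.disj i j fun e => hij (e ▸ rfl)
  conn i := by cases i with
    | inl i => exact h.conn i
    | inr i => exact h'.conn i

/-- A spanning tree of the component of `L` that contains `S` does it; hence no construction below
has to care about cycles. -/
lemma exists_isSteinerTree_of_connects {L : SimpleGraph W} (hL : L ≤ H) (hS : L.Connects S) :
    ∃ T : H.Subgraph, H.IsSteinerTree S T ∧ ∀ x y, T.Adj x y → L.Adj x y := by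
  obtain ⟨r, hr⟩ := hS
  let C := L.connectedComponentMk r
  obtain ⟨T, hTC, hT⟩ := C.connected_toSimpleGraph.exists_isTree_le
  refine ⟨{ verts := C.supp
            Adj := fun x y => ∃ (hx : x ∈ C) (hy : y ∈ C), T.Adj ⟨x, hx⟩ ⟨y, hy⟩
            adj_sub := ?_
            edge_vert := ?_
            symm := ?_ }, ⟨?_, ?_⟩, ?_⟩
  · rintro x y ⟨hx, hy, h⟩
    exact hL ((C.toSimpleGraph_adj hx hy).1 (hTC h))
  · rintro x y ⟨hx, -, -⟩
    exact hx
  · constructor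
    rintro x y ⟨hx, hy, h⟩
    exact ⟨hy, hx, h.symm⟩
  · refine Eq.subst (motive := IsTree) (SimpleGraph.ext ?_) hT
    ext ⟨x, hx⟩ ⟨y, hy⟩
    exact ⟨fun h => ⟨hx, hy, h⟩, fun ⟨_, _, h⟩ => h⟩
  · intro x hx
    exact ConnectedComponent.sound (hr x hx).symm
  · rintro x y ⟨hx, hy, h⟩
    exact (C.toSimpleGraph_adj hx hy).1 (hTC h)

lemma IsPacking.hasEdgeDisjointSteinerTrees [Finite ι] (h : IsPacking H S K) {n : ℕ}
    (hn : n ≤ Nat.card ι) : H.HasEdgeDisjointSteinerTrees S n := by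
  obtain ⟨f⟩ : Nonempty (Fin n ↪ ι) :=
    ⟨(Fin.castLEEmb hn).trans (Finite.equivFin ι).symm.toEmbedding⟩
  choose T hT hTK using fun i => exists_isSteinerTree_of_connects (h.le (f i)) (h.conn (f i))
  refine ⟨T, hT, fun i j hij => Set.disjoint_left.2 ?_⟩
  intro e
  induction e with | _ x y
  exact fun hi hj => h.disj _ _ (f.injective.ne hij) x y (hTK i x y hi) (hTK j x y hj)

lemma IsSteinerTree.connects {T : H.Subgraph} (hT : H.IsSteinerTree S T) (hS : S.Nonempty) :
    T.spanningCoe.Connects S := by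
  obtain ⟨r, hr⟩ := hS
  refine ⟨r, fun x hx => ?_⟩
  have h := hT.1.1.preconnected ⟨r, hT.2 hr⟩ ⟨x, hT.2 hx⟩
  exact h.map (⟨Subtype.val, fun h => h⟩ : T.coe →g T.spanningCoe)

lemma HasEdgeDisjointSteinerTrees.exists_isPacking {n : ℕ}
    (h : H.HasEdgeDisjointSteinerTrees S n) (hS : S.Nonempty) :
    ∃ K : Fin n → SimpleGraph W, IsPacking H S K := by
  obtain ⟨T, hT, hd⟩ := h
  refine ⟨fun i => (T i).spanningCoe, fun i => (T i).spanningCoe_le, ?_,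
    fun i => (hT i).connects hS⟩
  exact fun i j hij x y hi hj => Set.disjoint_left.1 (hd i j hij) (show s(x, y) ∈ (T i).edgeSet from hi) hj

lemma HasEdgeDisjointPaths.exists_isPacking {x y : W} {n : ℕ}
    (h : H.HasEdgeDisjointPaths x y n) :
    ∃ K : Fin n → SimpleGraph W, IsPacking H {x, y} K := by
  obtain ⟨P, hP⟩ := h
  refine ⟨fun i => (P i : H.Walk x y).toSubgraph.spanningCoe,
    fun i => Subgraph.spanningCoe_le _, ?_, ?_⟩
  · intro i j hij a b hi hj
    exact hP i j hij
      ((Walk.mem_edges_toSubgraph _).1 (show s(a, b) ∈ (P i : H.Walk x y).toSubgraph.edgeSet from hi))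
      ((Walk.mem_edges_toSubgraph _).1 (show s(a, b) ∈ (P j : H.Walk x y).toSubgraph.edgeSet from hj))
  · refine fun i => ⟨x, ?_⟩
    rintro z (rfl | rfl)
    · rfl
    · have h := (P i : H.Walk x z).toSubgraph_connected.preconnected
        ⟨x, Walk.start_mem_verts_toSubgraph _⟩ ⟨z, Walk.end_mem_verts_toSubgraph _⟩
      exact h.map (⟨Subtype.val, fun h => h⟩ :
        (P i : H.Walk x z).toSubgraph.coe →g (P i : H.Walk x z).toSubgraph.spanningCoe)

lemma Reachable.exists_adj {K : SimpleGraph W} {x y : W} (h : K.Reachable x y) (hxy : x ≠ y) :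
    ∃ z, K.Adj x z := by
  obtain ⟨p⟩ := h
  cases p with
  | nil => exact absurd rfl hxy
  | cons h _ => exact ⟨_, h⟩

lemma Connects.exists_adj {K : SimpleGraph W} (h : K.Connects S) {x y : W} (hx : x ∈ S)
    (hy : y ∈ S) (hxy : x ≠ y) : ∃ z, K.Adj x z :=
  (h.reachable hx hy).exists_adj hxy

/-- The members leave `x` along different edges, hence towards different neighbours. -/
lemma IsPacking.card_le_ncard_neighborSet [Finite W] (h : IsPacking H S K) {x y : W}
    (hx : x ∈ S) (hy : y ∈ S) (hxy : x ≠ y) : Nat.card ι ≤ (H.neighborSet x).ncard := by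
  choose z hz using fun i => (h.conn i).exists_adj hx hy hxy
  refine Nat.card_le_card_of_injective (β := H.neighborSet x)
    (fun i => ⟨z i, h.le i (hz i)⟩) fun i j hij => ?_
  by_contra hne
  have : z i = z j := congrArg Subtype.val hij
  exact h.disj i j hne x (z i) (hz i) (this ▸ hz j)

/-- The supremum defining λ(S) is attained, as it is taken over a bounded set containing `0`; an
optimal packing is then cut down to the minimum over all `S`. -/
lemma exists_isPacking_generalizedEdgeConnectivity [Finite W] (H : SimpleGraph W) {k : ℕ}
    (hk : 2 ≤ k) {S : Finset W} (hS : S.card = k) :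
    ∃ K : Fin (H.generalizedEdgeConnectivity k) → SimpleGraph W, IsPacking H S K := by
  have hnt : (S : Set W).Nontrivial :=
    Finset.one_lt_card_iff_nontrivial.1 (by omega)
  have h1 : H.HasEdgeDisjointSteinerTrees S (H.generalizedLocalEdgeConnectivity S) :=
    Nat.sSup_mem (s := {m | H.HasEdgeDisjointSteinerTrees S m})
      ⟨0, fun i => i.elim0, fun i => i.elim0, fun i => i.elim0⟩
      (bddAbove_hasEdgeDisjointSteinerTrees H _ hnt)
  have h2 : H.generalizedEdgeConnectivity k ≤ H.generalizedLocalEdgeConnectivity S :=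
    Nat.sInf_le ⟨S, hS, rfl⟩
  obtain ⟨K, hK⟩ := h1.exists_isPacking hnt.nonempty
  exact ⟨_, hK.comp (Fin.castLEEmb h2)⟩

lemma exists_isPacking_edgeConnectivity [Finite W] (H : SimpleGraph W) {x y : W}
    (hxy : x ≠ y) :
    ∃ K : Fin H.edgeConnectivity → SimpleGraph W, IsPacking H {x, y} K := by
  have h1 : H.HasEdgeDisjointPaths x y (H.localEdgeConnectivity x y) :=
    Nat.sSup_mem (s := {m | H.HasEdgeDisjointPaths x y m})
      ⟨0, fun i => i.elim0, fun i => i.elim0⟩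
      (bddAbove_hasEdgeDisjointPaths H _ _ hxy)
  have h2 : H.edgeConnectivity ≤ H.localEdgeConnectivity x y :=
    Nat.sInf_le ⟨x, y, hxy, rfl⟩
  obtain ⟨K, hK⟩ := h1.exists_isPacking
  exact ⟨_, hK.comp (Fin.castLEEmb h2)⟩

/-- The infimum of the empty set would be `0`; `hW` supplies a set of size `k`. -/
lemma le_generalizedEdgeConnectivity [Fintype W] {k n : ℕ} (hk : 2 ≤ k)
    (hW : k ≤ Fintype.card W)
    (h : ∀ S : Finset W, S.card = k → H.HasEdgeDisjointSteinerTrees S n) :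
    n ≤ H.generalizedEdgeConnectivity k := by
  obtain ⟨S, -, hS⟩ := Finset.exists_subset_card_eq (s := (Finset.univ : Finset W)) hW
  refine le_csInf ⟨_, S, hS, rfl⟩ ?_
  rintro m ⟨S, hS, rfl⟩
  refine le_csSup (bddAbove_hasEdgeDisjointSteinerTrees H _ ?_) (h S hS)
  exact Finset.one_lt_card_iff_nontrivial.1 (by omega)

end Packing

/-! ### Subgraphs of the total graph -/

section TotalGraph

variable {V : Type*} (G : SimpleGraph V)

/-- The subgraph of the total graph of `G` whose edges between vertices, between a vertex and an
edge, and between edges of `G` are those selected by `A`, `I` and `L`. -/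
def totalSubgraph (A : SimpleGraph V) (I : V → G.edgeSet → Prop)
    (L : G.edgeSet → G.edgeSet → Prop) : SimpleGraph (V ⊕ G.edgeSet) where
  Adj
    | Sum.inl u, Sum.inl v => A.Adj u v ∧ G.Adj u v
    | Sum.inr e, Sum.inr f => (L e f ∨ L f e) ∧ G.lineGraph.Adj e f
    | Sum.inl v, Sum.inr e => I v e ∧ v ∈ (e : Sym2 V)
    | Sum.inr e, Sum.inl v => I v e ∧ v ∈ (e : Sym2 V)
  symm := ⟨by
    rintro (u | e) (v | f) h
    · exact ⟨h.1.symm, h.2.symm⟩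
    · exact h
    · exact h
    · exact ⟨h.1.symm, h.2.symm⟩⟩
  loopless := ⟨by
    rintro (u | e) h
    · exact G.irrefl h.2
    · exact G.lineGraph.irrefl h.2⟩

variable {G} {A A' : SimpleGraph V} {I I' : V → G.edgeSet → Prop}
  {L L' : G.edgeSet → G.edgeSet → Prop}

lemma totalSubgraph_le : G.totalSubgraph A I L ≤ G.totalGraph := by
  rintro (u | e) (v | f) h <;> exact h.2

/-- `L` and `L'` are read symmetrically, so `L'` must fail in both orders; one order of `L` is
enough because `hL` ranges over all ordered pairs. -/
lemma totalSubgraph_disjoint (hA : ∀ x y, A.Adj x y → ¬ A'.Adj x y)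
    (hI : ∀ v (e : G.edgeSet), v ∈ (e : Sym2 V) → I v e → ¬ I' v e)
    (hL : ∀ e f, G.lineGraph.Adj e f → L e f → ¬ L' e f ∧ ¬ L' f e) :
    ∀ x y, (G.totalSubgraph A I L).Adj x y → ¬ (G.totalSubgraph A' I' L').Adj x y := by
  rintro (u | e) (v | f) ⟨h, h'⟩ ⟨k, -⟩
  · exact hA _ _ h k
  · exact hI _ _ h' h k
  · exact hI _ _ h' h k
  · rcases h with h | h
    · have := hL _ _ h' h
      tauto
    · have := hL _ _ h'.symm h
      tauto

lemma Reachable.totalSubgraph_inl {x y : V} (h : A.Reachable x y) (hA : A ≤ G) :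
    (G.totalSubgraph A I L).Reachable (Sum.inl x) (Sum.inl y) :=
  h.map (⟨Sum.inl, fun h => ⟨h, hA h⟩⟩ : A →g G.totalSubgraph A I L)

lemma totalSubgraph_reachable_inl_inr {v : V} {e : G.edgeSet} (h : I v e)
    (hv : v ∈ (e : Sym2 V)) : (G.totalSubgraph A I L).Reachable (Sum.inl v) (Sum.inr e) :=
  Adj.reachable (G := G.totalSubgraph A I L) ⟨h, hv⟩

lemma totalSubgraph_reachable_inr_inr {e f : G.edgeSet} (h : L e f) {v : V}
    (he : v ∈ (e : Sym2 V)) (hf : v ∈ (f : Sym2 V)) :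
    (G.totalSubgraph A I L).Reachable (Sum.inr e) (Sum.inr f) := by
  -- A link from an edge to itself is allowed and void; it occurs when the tree edge chosen for a
  -- prescribed edge is that edge.
  by_cases hef : e = f
  · rw [hef]
  · exact Adj.reachable (G := G.totalSubgraph A I L)
      ⟨Or.inl h, lineGraph_adj_iff_exists.2 ⟨hef, v, he, hf⟩⟩

/-- If `x` and `y` are joined in `T ≤ G`, the edges of `T` at `x` and at `y` are joined in the line
graph of `T`. -/
lemma Reachable.totalSubgraph_inr {T : SimpleGraph V} (hT : T ≤ G)
    (hL : ∀ e f : G.edgeSet, (e : Sym2 V) ∈ T.edgeSet → (f : Sym2 V) ∈ T.edgeSet → L e f)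
    {x y : V} (h : T.Reachable x y) {e f : G.edgeSet}
    (he : (e : Sym2 V) ∈ T.edgeSet) (hx : x ∈ (e : Sym2 V))
    (hf : (f : Sym2 V) ∈ T.edgeSet) (hy : y ∈ (f : Sym2 V)) :
    (G.totalSubgraph A I L).Reachable (Sum.inr e) (Sum.inr f) := by
  obtain ⟨p⟩ := h
  induction p generalizing e with
  | nil => exact totalSubgraph_reachable_inr_inr (hL _ _ he hf) hx hy
  | @cons x z y hxz p ih =>
    exact (totalSubgraph_reachable_inr_inr (f := ⟨s(x, z), hT hxz⟩) (hL _ _ he hxz) hx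
      (Sym2.mem_mk_left _ _)).trans (ih hxz (Sym2.mem_mk_right _ _) hy)

/-- Distinct edges share at most one vertex. -/
lemma edgeSet_ext {e f : G.edgeSet} {x y : V} (hxy : x ≠ y) (hxe : x ∈ (e : Sym2 V))
    (hye : y ∈ (e : Sym2 V)) (hxf : x ∈ (f : Sym2 V)) (hyf : y ∈ (f : Sym2 V)) : e = f :=
  Subtype.ext (((Sym2.mem_and_mem_iff hxy).1 ⟨hxe, hye⟩).trans
    ((Sym2.mem_and_mem_iff hxy).1 ⟨hxf, hyf⟩).symm)

lemma exists_other_end (e : G.edgeSet) {v : V} (hv : v ∈ (e : Sym2 V)) :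
    ∃ w, w ≠ v ∧ G.Adj v w ∧ (e : Sym2 V) = s(v, w) := by
  obtain ⟨w, hw⟩ := Sym2.mem_iff_exists.1 hv
  have h : G.Adj v w := by
    have := e.2
    rwa [hw] at this
  exact ⟨w, h.ne', h, hw⟩

lemma exists_edge_of_connects {T : SimpleGraph V} (hT : T ≤ G) {S : Set V} (h : T.Connects S)
    {x y : V} (hx : x ∈ S) (hy : y ∈ S) (hxy : x ≠ y) :
    ∃ e : G.edgeSet, (e : Sym2 V) ∈ T.edgeSet ∧ x ∈ (e : Sym2 V) := by
  obtain ⟨z, hz⟩ := h.exists_adj hx hy hxy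
  exact ⟨⟨s(x, z), hT hz⟩, hz, Sym2.mem_mk_left _ _⟩

lemma IsPacking.eq_of_mem_edgeSet {ι : Type*} {S : Set V} {T : ι → SimpleGraph V}
    (hT : IsPacking G S T) {i j : ι} {e : Sym2 V} (hi : e ∈ (T i).edgeSet)
    (hj : e ∈ (T j).edgeSet) : i = j := by
  by_contra hne
  induction e with | _ x y
  exact hT.disj i j hne x y hi hj

/-- The number of edges at a vertex is at least the size of a packing. -/
lemma IsPacking.card_le_ncard_edges [Finite V] {ι : Type*} {S : Set V} {T : ι → SimpleGraph V}
    (hT : IsPacking G S T) {x y : V} (hx : x ∈ S) (hy : y ∈ S) (hxy : x ≠ y) :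
    Nat.card ι ≤ {e : G.edgeSet | x ∈ (e : Sym2 V)}.ncard := by
  choose e he hxe using fun i => exists_edge_of_connects (hT.le i) (hT.conn i) hx hy hxy
  refine Nat.card_le_card_of_injective (β := {e : G.edgeSet | x ∈ (e : Sym2 V)})
    (fun i => ⟨e i, hxe i⟩) fun i j hij => ?_
  have : e i = e j := congrArg Subtype.val hij
  exact hT.eq_of_mem_edgeSet (he i) (this ▸ he j)

/-- Every tree of a packing of `G` has an edge at every vertex of `S`, with property `P` if
possible. -/
lemma IsPacking.exists_edges {ι : Type*} {S : Set V} {T : ι → SimpleGraph V}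
    (hT : IsPacking G S T) (hS : S.Nontrivial) (P : G.edgeSet → Prop) :
    ∃ q : V → ι → G.edgeSet, ∀ x ∈ S, ∀ j, (q x j : Sym2 V) ∈ (T j).edgeSet ∧
      x ∈ (q x j : Sym2 V) ∧
      ((∃ f : G.edgeSet, (f : Sym2 V) ∈ (T j).edgeSet ∧ x ∈ (f : Sym2 V) ∧ P f) → P (q x j)) := by
  have h1 : ∀ x ∈ S, ∀ j, ∃ e : G.edgeSet, (e : Sym2 V) ∈ (T j).edgeSet ∧ x ∈ (e : Sym2 V) := by
    intro x hx j
    obtain ⟨y, hy, hxy⟩ := hS.exists_ne x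
    exact exists_edge_of_connects (hT.le j) (hT.conn j) hx hy hxy.symm
  have h2 : ∀ x j, ∃ e : G.edgeSet, x ∈ S → (e : Sym2 V) ∈ (T j).edgeSet ∧ x ∈ (e : Sym2 V) ∧
      ((∃ f : G.edgeSet, (f : Sym2 V) ∈ (T j).edgeSet ∧ x ∈ (f : Sym2 V) ∧ P f) → P e) := by
    intro x j
    by_cases hx : x ∈ S
    · by_cases h : ∃ f : G.edgeSet, (f : Sym2 V) ∈ (T j).edgeSet ∧ x ∈ (f : Sym2 V) ∧ P f
      · obtain ⟨f, hf⟩ := h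
        exact ⟨f, fun _ => ⟨hf.1, hf.2.1, fun _ => hf.2.2⟩⟩
      · obtain ⟨e, he⟩ := h1 x hx j
        exact ⟨e, fun _ => ⟨he.1, he.2, fun h' => absurd h' h⟩⟩
    · obtain ⟨y, hy⟩ := hS.nonempty
      obtain ⟨e, -⟩ := h1 y hy j
      exact ⟨e, fun h => absurd h hx⟩
  choose q hq using h2
  exact ⟨q, fun x hx j => hq x j hx⟩

section LineFamily

variable {ι : Type*} (T : ι → SimpleGraph V) (U : Set V) (D : Set G.edgeSet)
  (q : V → ι → G.edgeSet) (c : G.edgeSet → V)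

/-- The subgraph of the total graph of `G` made of the line graph of `T j`, an edge from every
vertex `v` in `U` to `q v j` and an edge from every `e` in `D` to `q (c e) j`. -/
def lineFamily (j : ι) : SimpleGraph (V ⊕ G.edgeSet) :=
  G.totalSubgraph ⊥ (fun v f => v ∈ U ∧ f = q v j)
    (fun e f => ((e : Sym2 V) ∈ (T j).edgeSet ∧ (f : Sym2 V) ∈ (T j).edgeSet) ∨
      (e ∈ D ∧ f = q (c e) j))

variable {T U D q c}

/-- The line graphs of edge-disjoint trees share no vertex, and every link ends in the tree it
serves. Two members can thus clash only on a link between two edges of `D` that is used from both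
sides, which `hDD` excludes. -/
lemma isPacking_lineFamily {S : Set V} (hT : IsPacking G S T) (hS : S.Nontrivial)
    (hq : ∀ v ∈ S, ∀ j, (q v j : Sym2 V) ∈ (T j).edgeSet ∧ v ∈ (q v j : Sym2 V))
    (hU : U ⊆ S) (hD : ∀ e ∈ D, c e ∈ S ∧ c e ∈ (e : Sym2 V))
    (hDD : ∀ e ∈ D, ∀ e' ∈ D, ∀ j k, e ≠ e' → q (c e) j = e' → q (c e') k ≠ e) :
    IsPacking G.totalGraph (Sum.inl '' U ∪ Sum.inr '' D) (lineFamily T U D q c) where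
  le _ := totalSubgraph_le
  disj i j hij := by
    have hTT : ∀ e : Sym2 V, e ∈ (T i).edgeSet → e ∈ (T j).edgeSet → False :=
      fun e h h' => hij (hT.eq_of_mem_edgeSet h h')
    have hp : ∀ e ∈ D, ∀ j, (q (c e) j : Sym2 V) ∈ (T j).edgeSet :=
      fun e he j => (hq _ (hD e he).1 j).1
    refine totalSubgraph_disjoint (fun _ _ h => h.elim) ?_ ?_
    · rintro v e - ⟨hv, rfl⟩ ⟨-, h⟩
      exact hTT _ (hq v (hU hv) i).1 (h ▸ (hq v (hU hv) j).1)
    · rintro e f hef (⟨he, hf⟩ | ⟨he, rfl⟩)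
      · refine ⟨?_, ?_⟩
        · rintro (⟨h, -⟩ | ⟨h, rfl⟩)
          · exact hTT _ he h
          · exact hTT _ hf (hp _ h j)
        · rintro (⟨h, -⟩ | ⟨h, rfl⟩)
          · exact hTT _ hf h
          · exact hTT _ he (hp _ h j)
      · refine ⟨?_, ?_⟩
        · rintro (⟨-, h⟩ | ⟨h, h'⟩)
          · exact hTT _ (hp _ he i) h
          · exact hTT _ (hp _ he i) (h' ▸ hp _ he j)
        · rintro (⟨h, -⟩ | ⟨h, h'⟩)
          · exact hTT _ (hp _ he i) h
          · exact hDD e he _ h i j hef.1 rfl h'.symm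
  conn j := by
    obtain ⟨x, hx⟩ := hS.nonempty
    have key : ∀ v ∈ S, (lineFamily T U D q c j).Reachable (Sum.inr (q x j)) (Sum.inr (q v j)) :=
      fun v hv => ((hT.conn j).reachable hx hv).totalSubgraph_inr (hT.le j)
        (fun _ _ h h' => Or.inl ⟨h, h'⟩) (hq x hx j).1 (hq x hx j).2 (hq v hv j).1 (hq v hv j).2
    refine ⟨Sum.inr (q x j), ?_⟩
    rintro _ (⟨v, hv, rfl⟩ | ⟨e, he, rfl⟩)
    · exact (key v (hU hv)).trans
        (totalSubgraph_reachable_inl_inr ⟨hv, rfl⟩ (hq v (hU hv) j).2).symm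
    · exact (key _ (hD e he).1).trans (totalSubgraph_reachable_inr_inr (Or.inr ⟨he, rfl⟩)
        (hD e he).2 (hq _ (hD e he).1 j).2).symm

end LineFamily

end TotalGraph

/-! ### Packings for each pattern of incidences -/

section Constructions

variable {V ι : Type*} {G : SimpleGraph V}

/-- Two edge-disjoint subgraphs `Ta` and `Tb` through the vertices `c e`, `e ∈ D`, can be modified
(by adding to `Tb` the edges in `D` missing in `Ta`) so that for every `e ∈ D` they reach different
ends of `e`. -/
lemma exists_distinct_ends {Ta Tb : SimpleGraph V} (hb : Tb ≤ G)
    (D : Set G.edgeSet) {c : G.edgeSet → V} (hc : ∀ e ∈ D, c e ∈ (e : Sym2 V)) :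
    ∃ (B : SimpleGraph V) (α β : G.edgeSet → V), B ≤ G ∧ Tb ≤ B ∧
      ((∀ x y, Ta.Adj x y → ¬ Tb.Adj x y) → ∀ x y, Ta.Adj x y → ¬ B.Adj x y) ∧
      ∀ e ∈ D, α e ∈ (e : Sym2 V) ∧ β e ∈ (e : Sym2 V) ∧ α e ≠ β e ∧
        Ta.Reachable (c e) (α e) ∧ B.Reachable (c e) (β e) := by
  classical
  have hw : ∀ e : G.edgeSet, ∃ w, e ∈ D → w ≠ c e ∧ (e : Sym2 V) = s(c e, w) := by
    intro e
    by_cases he : e ∈ D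
    · obtain ⟨w, h1, -, h2⟩ := exists_other_end e (hc e he)
      exact ⟨w, fun _ => ⟨h1, h2⟩⟩
    · exact ⟨c e, fun h => absurd h he⟩
  choose w hw using hw
  -- An edge in `Ta` takes `Ta` to its far end `w e` and leaves `c e` to `B`. An edge outside `Ta`
  -- may be added to `Tb`, so that `B` reaches `w e` and `Ta` keeps `c e`.
  refine ⟨Tb ⊔ (fromEdgeSet (Subtype.val '' D) \ Ta),
    fun e => if (e : Sym2 V) ∈ Ta.edgeSet then w e else c e,
    fun e => if (e : Sym2 V) ∈ Ta.edgeSet then c e else w e, ?_, le_sup_left, ?_, ?_⟩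
  · refine sup_le hb (sdiff_le.trans ?_)
    rintro x y ⟨⟨e, -, he⟩, -⟩
    have := e.2
    rwa [he] at this
  · rintro h x y hxy (hb | hb)
    · exact h x y hxy hb
    · exact hb.2 hxy
  · intro e he
    obtain ⟨h1, h2⟩ := hw e he
    have hwe : w e ∈ (e : Sym2 V) := h2 ▸ Sym2.mem_mk_right _ _
    by_cases hT : (e : Sym2 V) ∈ Ta.edgeSet
    · simp only [hT, if_true]
      refine ⟨hwe, hc e he, h1, Adj.reachable ?_, .rfl⟩
      rwa [h2] at hT
    · simp only [hT, if_false]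
      refine ⟨hc e he, hwe, h1.symm, .rfl, Adj.reachable (Or.inr ?_)⟩
      rw [h2] at hT
      exact ⟨⟨⟨e, he, h2⟩, h1.symm⟩, hT⟩

/-- Packings of the total graph for a set of vertices and edges without incidences. -/
lemma exists_isPacking_of_not_incident {S : Set V} {T : ι → SimpleGraph V}
    (hT : IsPacking G S T) (hS : S.Nontrivial) {U : Set V} {D : Set G.edgeSet} (hU : U ⊆ S)
    {c : G.edgeSet → V} (hc : ∀ e ∈ D, c e ∈ S ∧ c e ∈ (e : Sym2 V)) (hinj : Set.InjOn c D)
    (hUD : ∀ u ∈ U, ∀ e ∈ D, u ∉ (e : Sym2 V)) (a b : ι) :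
    (∃ K : Option ι → _, IsPacking G.totalGraph (Sum.inl '' U ∪ Sum.inr '' D) K) ∧
    (a ≠ b → ∃ K : Option (Option ι) → _,
      IsPacking G.totalGraph (Sum.inl '' U ∪ Sum.inr '' D) K) := by
  obtain ⟨q, hq⟩ := hT.exists_edges hS fun _ => True
  have hL := isPacking_lineFamily (q := q) hT hS (fun v hv j => ⟨(hq v hv j).1, (hq v hv j).2.1⟩)
    hU hc (by
      -- Edges linked to each other would both contain the distinct vertices `c e` and `c e'`.
      intro e he e' he' j k hne h h'
      have h1 := (hq _ (hc e he).1 j).2.1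
      have h2 := (hq _ (hc e' he').1 k).2.1
      rw [h] at h1
      rw [h'] at h2
      exact hne (edgeSet_ext (hinj.ne he he' hne) (hc e he).2 h2 h1 (hc e' he').2))
  obtain ⟨B, α, β, hB, hbB, hAB, hαβ⟩ := exists_distinct_ends (Ta := T a) (hT.le b) D
    fun e he => (hc e he).2
  obtain ⟨s, hs⟩ := hS.nonempty
  have hLA := hL.option (A := G.totalSubgraph (T a) (fun v e => e ∈ D ∧ v = α e) fun _ _ => False)
    totalSubgraph_le (by
      refine ⟨Sum.inl s, ?_⟩
      rintro _ (⟨v, hv, rfl⟩ | ⟨e, he, rfl⟩)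
      · exact ((hT.conn a).reachable hs (hU hv)).totalSubgraph_inl (hT.le a)
      · exact ((((hT.conn a).reachable hs (hc e he).1).trans (hαβ e he).2.2.2.1).totalSubgraph_inl
          (hT.le a)).trans (totalSubgraph_reachable_inl_inr ⟨he, rfl⟩ (hαβ e he).1))
    (fun j => totalSubgraph_disjoint (fun _ _ h => h.elim)
      (fun v e hve h h' => hUD v h.1 e h'.1 hve) fun _ _ _ _ => by simp)
  refine ⟨⟨_, hLA⟩, fun hab => ⟨_, hLA.option
    (A := G.totalSubgraph B (fun v e => e ∈ D ∧ v = β e) fun _ _ => False) totalSubgraph_le ?_ ?_⟩⟩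
  · refine ⟨Sum.inl s, ?_⟩
    rintro _ (⟨v, hv, rfl⟩ | ⟨e, he, rfl⟩)
    · exact (((hT.conn b).reachable hs (hU hv)).mono hbB).totalSubgraph_inl hB
    · exact (((((hT.conn b).reachable hs (hc e he).1).mono hbB).trans
        (hαβ e he).2.2.2.2).totalSubgraph_inl hB).trans
        (totalSubgraph_reachable_inl_inr ⟨he, rfl⟩ (hαβ e he).2.1)
  · rintro (_ | j)
    · refine totalSubgraph_disjoint (hAB (hT.disj a b hab)) ?_ fun _ _ _ h => h.elim
      rintro v e - ⟨he, rfl⟩ ⟨-, h⟩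
      exact (hαβ e he).2.2.1 h
    · exact totalSubgraph_disjoint (fun _ _ h => h.elim)
        (fun v e hve h h' => hUD v h.1 e h'.1 hve) fun _ _ _ _ => by simp

/-- Packings of the total graph for a set of vertices and edges with exactly one incident pair,
`u` and `e₁`. For the second one, `B` reaches `e₁` from `x` through `h`. -/
lemma exists_isPacking_of_incident {S : Set V} {T : ι → SimpleGraph V}
    (hT : IsPacking G S T) (hS : S.Nontrivial) {U : Set V} {D : Set G.edgeSet} (hU : U ⊆ S)
    {c : G.edgeSet → V} (hc : ∀ e ∈ D, c e ∈ S ∧ c e ∈ (e : Sym2 V)) (hinj : Set.InjOn c D)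
    (hUD : ∀ v ∈ U, ∀ e ∈ D, v ∉ (e : Sym2 V)) {u w : V} (hu : u ∈ U) (hwS : w ∈ S) (hwU : w ∉ U)
    {e₁ : G.edgeSet} (he₁ : (e₁ : Sym2 V) = s(u, w))
    {q : V → ι → G.edgeSet}
    (hq : ∀ x ∈ S, ∀ j, (q x j : Sym2 V) ∈ (T j).edgeSet ∧ x ∈ (q x j : Sym2 V)) (a b : ι) :
    (∃ K : Option ι → _, IsPacking G.totalGraph (Sum.inl '' U ∪ Sum.inr '' (insert e₁ D)) K) ∧
    (a ≠ b → (∃ x ∈ S, ∃ h : G.edgeSet, x ∈ (h : Sym2 V) ∧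
        (∃ z ∈ (h : Sym2 V), z ∈ (e₁ : Sym2 V)) ∧ (x ∈ U → ∀ j, h ≠ q x j) ∧ h ∉ D ∧
        (x = w → h ≠ e₁) ∧ (h ≠ e₁ → ∀ j,
          ¬ ((h : Sym2 V) ∈ (T j).edgeSet ∧ (e₁ : Sym2 V) ∈ (T j).edgeSet) ∧ h ≠ q u j)) →
      ∃ K : Option (Option ι) → _,
        IsPacking G.totalGraph (Sum.inl '' U ∪ Sum.inr '' (insert e₁ D)) K) := by
  classical
  have hue : u ∈ (e₁ : Sym2 V) := he₁ ▸ Sym2.mem_mk_left _ _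
  have hwe : w ∈ (e₁ : Sym2 V) := he₁ ▸ Sym2.mem_mk_right _ _
  have hD₁ : e₁ ∉ D := fun h => hUD u hu _ h hue
  -- With `e₁` represented by `u`, the line family may use the incidence of `u` and `e₁`, but never
  -- that of `w` and `e₁`, which is left to the copy of `T a`.
  let c' := Function.update c e₁ u
  have hc₁ : c' e₁ = u := Function.update_self ..
  have hcD : ∀ e ∈ D, c' e = c e := fun e he =>
    Function.update_of_ne (fun h : e = e₁ => hD₁ (h ▸ he)) _ _
  have hL := isPacking_lineFamily (q := q) (D := insert e₁ D) (c := c') hT hS hq hU (by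
      rintro e (rfl | he)
      · rw [hc₁]
        exact ⟨hU hu, hue⟩
      · rw [hcD e he]
        exact hc e he) (by
      rintro e (rfl | he) e' (rfl | he') j k hne h h'
      · exact hne rfl
      · rw [hc₁] at h
        exact hUD u hu _ he' (h ▸ (hq u (hU hu) j).2)
      · rw [hc₁] at h'
        exact hUD u hu _ he (h' ▸ (hq u (hU hu) k).2)
      · rw [hcD _ he] at h
        rw [hcD _ he'] at h'
        have h1 := (hq _ (hc e he).1 j).2
        have h2 := (hq _ (hc e' he').1 k).2
        rw [h] at h1
        rw [h'] at h2
        exact hne (edgeSet_ext (hinj.ne he he' hne) (hc e he).2 h2 h1 (hc e' he').2))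
  obtain ⟨B, α, β, hB, hbB, hAB, hαβ⟩ := exists_distinct_ends (Ta := T a) (hT.le b) D
    fun e he => (hc e he).2
  have hLA := hL.option (A := G.totalSubgraph (T a)
      (fun v e => (v = w ∧ e = e₁) ∨ (e ∈ D ∧ v = α e)) fun _ _ => False)
    totalSubgraph_le (by
      refine ⟨Sum.inl w, ?_⟩
      rintro _ (⟨v, hv, rfl⟩ | ⟨e, rfl | he, rfl⟩)
      · exact ((hT.conn a).reachable hwS (hU hv)).totalSubgraph_inl (hT.le a)
      · exact totalSubgraph_reachable_inl_inr (Or.inl ⟨rfl, rfl⟩) hwe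
      · exact ((((hT.conn a).reachable hwS (hc e he).1).trans
          (hαβ e he).2.2.2.1).totalSubgraph_inl (hT.le a)).trans
          (totalSubgraph_reachable_inl_inr (Or.inr ⟨he, rfl⟩) (hαβ e he).1))
    (fun j => totalSubgraph_disjoint (fun _ _ h => h.elim)
      (by
        rintro v e hve ⟨hv, -⟩ (⟨rfl, -⟩ | ⟨he, -⟩)
        · exact hwU hv
        · exact hUD v hv e he hve) fun _ _ _ _ => by simp)
  refine ⟨⟨_, hLA⟩, ?_⟩
  -- `hqU`, `hhw` and `hhD` keep the link from `x` to `h` off those already used; `hh` and `hhD` do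
  -- so for the link from `h` to `e₁`, which is void if `h = e₁`.
  rintro hab ⟨x, hx, h, hxh, ⟨z, hzh, hze⟩, hqU, hhD, hhw, hh⟩
  refine ⟨_, hLA.option (A := G.totalSubgraph B
    (fun v e => (e ∈ D ∧ v = β e) ∨ (v = x ∧ e = h)) fun e f => e = e₁ ∧ f = h)
    totalSubgraph_le ?_ ?_⟩
  · refine ⟨Sum.inl x, ?_⟩
    rintro _ (⟨v, hv, rfl⟩ | ⟨e, rfl | he, rfl⟩)
    · exact (((hT.conn b).reachable hx (hU hv)).mono hbB).totalSubgraph_inl hB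
    · exact (totalSubgraph_reachable_inl_inr (Or.inr ⟨rfl, rfl⟩) hxh).trans
        (totalSubgraph_reachable_inr_inr ⟨rfl, rfl⟩ hze hzh).symm
    · exact (((((hT.conn b).reachable hx (hc e he).1).mono hbB).trans
        (hαβ e he).2.2.2.2).totalSubgraph_inl hB).trans
        (totalSubgraph_reachable_inl_inr (Or.inl ⟨he, rfl⟩) (hαβ e he).2.1)
  · rintro (_ | j)
    · refine totalSubgraph_disjoint (hAB (hT.disj a b hab)) ?_ fun _ _ _ h => h.elim
      rintro v e - (⟨rfl, rfl⟩ | ⟨he, rfl⟩) (⟨he', h'⟩ | ⟨h', h''⟩)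
      · exact hD₁ he'
      · exact hhw h'.symm h''.symm
      · exact (hαβ e he).2.2.1 h'
      · exact hhD (h'' ▸ he)
    · refine totalSubgraph_disjoint (fun _ _ h => h.elim) ?_ ?_
      · rintro v e hve ⟨hv, h1⟩ (⟨he, -⟩ | ⟨rfl, rfl⟩)
        · exact hUD v hv e he hve
        · exact hqU hv j h1
      · rintro e f hef (⟨he, hf⟩ | ⟨rfl | he, rfl⟩)
        · refine ⟨?_, ?_⟩
          · rintro ⟨rfl, rfl⟩
            exact (hh hef.1.symm j).1 ⟨hf, he⟩
          · rintro ⟨rfl, rfl⟩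
            exact (hh hef.1 j).1 ⟨he, hf⟩
        · refine ⟨?_, ?_⟩
          · rintro ⟨-, h1⟩
            exact (hh (fun h2 => hef.1 (h2 ▸ h1.symm)) j).2 (hc₁ ▸ h1.symm)
          · rintro ⟨h1, -⟩
            exact hef.1 h1.symm
        · refine ⟨?_, ?_⟩
          · rintro ⟨rfl, -⟩
            exact hD₁ he
          · rintro ⟨-, rfl⟩
            exact hhD he

/-- Packings of the total graph for an edge and its two ends. -/
lemma exists_isPacking_of_both_ends {u w : V} {T : ι → SimpleGraph V}
    (hT : IsPacking G {u, w} T) (e : G.edgeSet) (he : (e : Sym2 V) = s(u, w))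
    (heT : ∀ j, (e : Sym2 V) ∉ (T j).edgeSet) :
    ∃ K : Option (ι ⊕ ι) → _,
      IsPacking G.totalGraph (Sum.inl '' {u, w} ∪ Sum.inr '' {e}) K := by
  have huw : u ≠ w := by
    have := e.2
    rw [he] at this
    exact this.ne
  have hue : u ∈ (e : Sym2 V) := he ▸ Sym2.mem_mk_left _ _
  have hwe : w ∈ (e : Sym2 V) := he ▸ Sym2.mem_mk_right _ _
  have hS : ({u, w} : Set V).Nontrivial := Set.nontrivial_pair huw
  have hu : u ∈ ({u, w} : Set V) := Set.mem_insert _ _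
  have hw : w ∈ ({u, w} : Set V) := Set.mem_insert_of_mem _ rfl
  obtain ⟨q, hq'⟩ := hT.exists_edges hS fun _ => True
  have hq : ∀ x ∈ ({u, w} : Set V), ∀ j, (q x j : Sym2 V) ∈ (T j).edgeSet ∧
    x ∈ (q x j : Sym2 V) := fun x hx j => ⟨(hq' x hx j).1, (hq' x hx j).2.1⟩
  have hqe : ∀ x ∈ ({u, w} : Set V), ∀ j, q x j ≠ e := fun x hx j h =>
    heT j (h ▸ (hq x hx j).1)
  have hquw : ∀ i j, q u i ≠ q w j := fun i j h =>
    hqe u hu i (edgeSet_ext huw (hq u hu i).2 (h ▸ (hq w hw j).2) hue hwe)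
  have hL := isPacking_lineFamily (q := q) (U := {u, w}) (D := {e}) (c := fun _ => u) hT hS hq
    subset_rfl (by rintro _ rfl; exact ⟨hu, hue⟩)
    (by rintro _ rfl _ rfl _ _ h; exact absurd rfl h)
  choose z hzw hz1 hz2 using fun j => exists_other_end (q w j) (hq w hw j).2
  have hzu : ∀ j, z j ≠ u := by
    rintro j rfl
    exact hqe w hw j (Subtype.ext ((hz2 j).trans (Sym2.eq_swap.trans he.symm)))
  have hzq : ∀ j, z j ∈ (q w j : Sym2 V) := fun j => hz2 j ▸ Sym2.mem_mk_right _ _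
  -- The tree `T j` contains the edge `q w j` from `w` to `z j`. Reaching `e` by `z j`, `q w j`, `e`
  -- avoids the links of the line family, which join `w` to `q w j` and both `u` and `e` to `q u j`.
  let C : ι → SimpleGraph (V ⊕ G.edgeSet) := fun j => G.totalSubgraph (T j)
    (fun v f => v = z j ∧ f = q w j) fun f g => f = e ∧ g = q w j
  have hC : IsPacking G.totalGraph (Sum.inl '' {u, w} ∪ Sum.inr '' {e}) C := by
    refine ⟨fun _ => totalSubgraph_le, fun i j hij => ?_, fun j => ?_⟩
    · have hqq : q w i ≠ q w j := fun h => hij <|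
        hT.eq_of_mem_edgeSet (hq w hw i).1 (h ▸ (hq w hw j).1)
      refine totalSubgraph_disjoint (hT.disj i j hij) ?_ ?_
      · rintro v f - ⟨-, h⟩ ⟨-, h'⟩
        exact hqq (h.symm.trans h')
      · rintro f g - ⟨rfl, rfl⟩
        exact ⟨fun h => hqq h.2, fun h => hqe w hw i h.1⟩
    · refine ⟨Sum.inl w, ?_⟩
      rintro _ (⟨v, hv, rfl⟩ | ⟨_, rfl, rfl⟩)
      · exact ((hT.conn j).reachable hw hv).totalSubgraph_inl (hT.le j)
      · have h : (T j).Adj w (z j) := by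
          have := (hq w hw j).1
          rwa [hz2] at this
        exact ((h.reachable.totalSubgraph_inl (hT.le j)).trans
          (totalSubgraph_reachable_inl_inr ⟨rfl, rfl⟩ (hzq j))).trans
          (totalSubgraph_reachable_inr_inr ⟨rfl, rfl⟩ hwe (hq w hw j).2).symm
  have hLC := hL.sum hC (by
    refine fun i j => totalSubgraph_disjoint (fun _ _ h => h.elim) ?_ ?_
    · rintro v f - ⟨rfl | rfl, rfl⟩ ⟨h, h'⟩
      · exact hzu j h.symm
      · exact hzw j h.symm
    · rintro f g - (⟨hf, hg⟩ | ⟨rfl, rfl⟩)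
      · refine ⟨?_, ?_⟩
        · rintro ⟨rfl, -⟩
          exact heT i hf
        · rintro ⟨rfl, -⟩
          exact heT i hg
      · exact ⟨fun h => hquw _ _ h.2, fun h => hqe _ hu _ h.1⟩)
  -- The extra member is the edge `uw` of the copy of `G`, unused by `heT`, with the incidence of
  -- `u` and `e`.
  refine ⟨_, hLC.option (A := G.totalSubgraph (fromEdgeSet {(e : Sym2 V)})
    (fun v f => v = u ∧ f = e) fun _ _ => False) totalSubgraph_le ?_ ?_⟩
  · refine ⟨Sum.inl u, ?_⟩
    rintro _ (⟨v, rfl | rfl, rfl⟩ | ⟨_, rfl, rfl⟩)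
    · rfl
    · refine Adj.reachable ⟨?_, ?_⟩
      · simp [he, huw]
      · have := e.2
        rwa [he] at this
    · exact totalSubgraph_reachable_inl_inr ⟨rfl, rfl⟩ hue
  · rintro (i | j)
    · refine totalSubgraph_disjoint (fun _ _ h => h.elim) ?_ fun _ _ _ _ => by simp
      rintro v f - ⟨hv, rfl⟩ ⟨-, h⟩
      exact hqe v hv i h
    · refine totalSubgraph_disjoint ?_ ?_ fun _ _ _ _ => by simp
      · rintro x y h h'
        rw [fromEdgeSet_adj, Set.mem_singleton_iff] at h'
        exact heT j (h'.1 ▸ h)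
      · rintro v f - ⟨-, rfl⟩ ⟨-, h⟩
        exact hqe w hw j h

/-- Packings of the total graph for a vertex `u` and two edges `uw₁` and `uw₂`. -/
lemma exists_isPacking_of_two_incident {u w₁ w₂ : V} {T : ι → SimpleGraph V}
    {S : Set V} (hT : IsPacking G S T) (hu : u ∈ S) (hw₁ : w₁ ∈ S) (hw₂ : w₂ ∈ S)
    {e₁ e₂ : G.edgeSet} (he₁ : (e₁ : Sym2 V) = s(u, w₁)) (he₂ : (e₂ : Sym2 V) = s(u, w₂))
    (hee : e₁ ≠ e₂) (a b c : ι) :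
    (∃ K : Option (Option {g : G.edgeSet // u ∈ (g : Sym2 V) ∧ g ≠ e₁ ∧ g ≠ e₂}) → _,
      IsPacking G.totalGraph (Sum.inl '' {u} ∪ Sum.inr '' {e₁, e₂}) K) ∧
    (a ≠ b → ∀ h₁ h₂ : G.edgeSet, w₁ ∈ (h₁ : Sym2 V) → h₁ ≠ e₁ → w₂ ∈ (h₂ : Sym2 V) → h₂ ≠ e₂ →
      (∃ K : Option (Option (Option {g : G.edgeSet // u ∈ (g : Sym2 V) ∧ g ≠ e₁ ∧ g ≠ e₂})) → _,
        IsPacking G.totalGraph (Sum.inl '' {u} ∪ Sum.inr '' {e₁, e₂}) K) ∧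
      (a ≠ c → b ≠ c → ∀ h₃ : G.edgeSet, w₁ ∈ (h₃ : Sym2 V) → h₃ ≠ e₁ → h₃ ≠ h₁ →
        ∃ K : Option (Option (Option (Option
            {g : G.edgeSet // u ∈ (g : Sym2 V) ∧ g ≠ e₁ ∧ g ≠ e₂}))) → _,
          IsPacking G.totalGraph (Sum.inl '' {u} ∪ Sum.inr '' {e₁, e₂}) K)) := by
  have huw₁ : u ≠ w₁ := by
    have := e₁.2
    rw [he₁] at this
    exact this.ne
  have huw₂ : u ≠ w₂ := by
    have := e₂.2
    rw [he₂] at this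
    exact this.ne
  have hww : w₁ ≠ w₂ := by
    rintro rfl
    exact hee (Subtype.ext (he₁.trans he₂.symm))
  have hue₁ : u ∈ (e₁ : Sym2 V) := he₁ ▸ Sym2.mem_mk_left _ _
  have hue₂ : u ∈ (e₂ : Sym2 V) := he₂ ▸ Sym2.mem_mk_left _ _
  have hwe₁ : w₁ ∈ (e₁ : Sym2 V) := he₁ ▸ Sym2.mem_mk_right _ _
  have hwe₂ : w₂ ∈ (e₂ : Sym2 V) := he₂ ▸ Sym2.mem_mk_right _ _
  have hu₁ : ∀ h : G.edgeSet, w₁ ∈ (h : Sym2 V) → h ≠ e₁ → u ∉ (h : Sym2 V) :=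
    fun h h1 h2 h3 => h2 (edgeSet_ext huw₁ h3 h1 hue₁ hwe₁)
  have hu₂ : ∀ h : G.edgeSet, w₂ ∈ (h : Sym2 V) → h ≠ e₂ → u ∉ (h : Sym2 V) :=
    fun h h1 h2 h3 => h2 (edgeSet_ext huw₂ h3 h1 hue₂ hwe₂)
  let N := {g : G.edgeSet // u ∈ (g : Sym2 V) ∧ g ≠ e₁ ∧ g ≠ e₂}
  -- Each further edge at `u` is adjacent to all three prescribed elements.
  let star : N → SimpleGraph (V ⊕ G.edgeSet) := fun g => G.totalSubgraph ⊥
    (fun v f => v = u ∧ f = g) fun f f' => f = g ∧ (f' = e₁ ∨ f' = e₂)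
  have hstar : IsPacking G.totalGraph (Sum.inl '' {u} ∪ Sum.inr '' {e₁, e₂}) star := by
    refine ⟨fun _ => totalSubgraph_le, fun i j hij => ?_, fun g => ?_⟩
    · have hij' : (i : G.edgeSet) ≠ j := fun h => hij (Subtype.ext h)
      refine totalSubgraph_disjoint (fun _ _ h => h.elim) ?_ ?_
      · rintro v f - ⟨-, rfl⟩ ⟨-, h⟩
        exact hij' h
      · rintro f f' - ⟨rfl, h⟩
        refine ⟨fun h' => hij' h'.1, ?_⟩
        rintro ⟨-, h' | h'⟩
        · exact i.2.2.1 h'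
        · exact i.2.2.2 h'
    · refine ⟨Sum.inr g.1, ?_⟩
      rintro _ (⟨_, rfl, rfl⟩ | ⟨_, rfl | rfl, rfl⟩)
      · exact (totalSubgraph_reachable_inl_inr ⟨rfl, rfl⟩ g.2.1).symm
      · exact totalSubgraph_reachable_inr_inr ⟨rfl, Or.inl rfl⟩ g.2.1 hue₁
      · exact totalSubgraph_reachable_inr_inr ⟨rfl, Or.inr rfl⟩ g.2.1 hue₂
  -- The path `u`, `e₁`, `e₂`.
  have hP := hstar.option (A := G.totalSubgraph ⊥ (fun v f => v = u ∧ f = e₁)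
      fun f f' => f = e₁ ∧ f' = e₂) totalSubgraph_le (by
      refine ⟨Sum.inr e₁, ?_⟩
      rintro _ (⟨_, rfl, rfl⟩ | ⟨_, rfl | rfl, rfl⟩)
      · exact (totalSubgraph_reachable_inl_inr ⟨rfl, rfl⟩ hue₁).symm
      · rfl
      · exact totalSubgraph_reachable_inr_inr ⟨rfl, rfl⟩ hue₁ hue₂) (by
      refine fun g => totalSubgraph_disjoint (fun _ _ h => h.elim) ?_ ?_
      · rintro v f - ⟨-, h⟩ ⟨-, h'⟩
        exact g.2.2.1 (h.symm.trans h')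
      · rintro f f' - ⟨h, -⟩
        exact ⟨fun h' => g.2.2.1 (h.symm.trans h'.1), fun h' => g.2.2.2 (h.symm.trans h'.2)⟩)
  have hA := hP.option (A := G.totalSubgraph (T a)
      (fun v f => (v = w₁ ∧ f = e₁) ∨ (v = w₂ ∧ f = e₂)) fun _ _ => False) totalSubgraph_le (by
      refine ⟨Sum.inl u, ?_⟩
      rintro _ (⟨_, rfl, rfl⟩ | ⟨_, rfl | rfl, rfl⟩)
      · rfl
      · exact (((hT.conn a).reachable hu hw₁).totalSubgraph_inl (hT.le a)).trans
          (totalSubgraph_reachable_inl_inr (Or.inl ⟨rfl, rfl⟩) hwe₁)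
      · exact (((hT.conn a).reachable hu hw₂).totalSubgraph_inl (hT.le a)).trans
          (totalSubgraph_reachable_inl_inr (Or.inr ⟨rfl, rfl⟩) hwe₂)) (by
      rintro (_ | g) <;> refine totalSubgraph_disjoint (fun _ _ h => h.elim) ?_
        (fun _ _ _ _ => by simp) <;> grind)
  refine ⟨⟨_, hA⟩, fun hab h₁ h₂ hh₁ hhe₁ hh₂ hhe₂ => ?_⟩
  have huh₁ := hu₁ h₁ hh₁ hhe₁
  have huh₂ := hu₂ h₂ hh₂ hhe₂
  have hB := hA.option (A := G.totalSubgraph (T b)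
      (fun v f => (v = w₁ ∧ f = h₁) ∨ (v = w₂ ∧ f = h₂))
      fun f f' => (f = e₁ ∧ f' = h₁) ∨ (f = e₂ ∧ f' = h₂)) totalSubgraph_le (by
      refine ⟨Sum.inl u, ?_⟩
      rintro _ (⟨_, rfl, rfl⟩ | ⟨_, rfl | rfl, rfl⟩)
      · rfl
      · exact ((((hT.conn b).reachable hu hw₁).totalSubgraph_inl (hT.le b)).trans
          (totalSubgraph_reachable_inl_inr (Or.inl ⟨rfl, rfl⟩) hh₁)).trans
          (totalSubgraph_reachable_inr_inr (Or.inl ⟨rfl, rfl⟩) hwe₁ hh₁).symm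
      · exact ((((hT.conn b).reachable hu hw₂).totalSubgraph_inl (hT.le b)).trans
          (totalSubgraph_reachable_inl_inr (Or.inr ⟨rfl, rfl⟩) hh₂)).trans
          (totalSubgraph_reachable_inr_inr (Or.inr ⟨rfl, rfl⟩) hwe₂ hh₂).symm) (by
      rintro (_ | _ | g)
      · exact totalSubgraph_disjoint (hT.disj a b hab) (by grind) fun _ _ _ h => h.elim
      · exact totalSubgraph_disjoint (fun _ _ h => h.elim) (by grind) (by grind)
      · have := g.2
        exact totalSubgraph_disjoint (fun _ _ h => h.elim) (by grind) (by grind))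
  refine ⟨⟨_, hB⟩, fun hac hbc h₃ hh₃ hhe₃ hh₁₃ => ?_⟩
  have huh₃ := hu₁ h₃ hh₃ hhe₃
  -- The incidence of `u` and `e₂` is still free, so only `e₁` needs another detour, through `h₃`.
  refine ⟨_, hB.option (A := G.totalSubgraph (T c)
    (fun v f => (v = u ∧ f = e₂) ∨ (v = w₁ ∧ f = h₃)) fun f f' => f = e₁ ∧ f' = h₃)
    totalSubgraph_le ?_ ?_⟩
  · refine ⟨Sum.inl u, ?_⟩
    rintro _ (⟨_, rfl, rfl⟩ | ⟨_, rfl | rfl, rfl⟩)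
    · rfl
    · exact ((((hT.conn c).reachable hu hw₁).totalSubgraph_inl (hT.le c)).trans
        (totalSubgraph_reachable_inl_inr (Or.inr ⟨rfl, rfl⟩) hh₃)).trans
        (totalSubgraph_reachable_inr_inr ⟨rfl, rfl⟩ hwe₁ hh₃).symm
    · exact totalSubgraph_reachable_inl_inr (Or.inl ⟨rfl, rfl⟩) hue₂
  · rintro (_ | _ | _ | g)
    · exact totalSubgraph_disjoint (hT.disj b c hbc) (by grind) (by grind)
    · exact totalSubgraph_disjoint (hT.disj a c hac) (by grind) fun _ _ _ h => h.elim
    · exact totalSubgraph_disjoint (fun _ _ h => h.elim) (by grind) (by grind)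
    · have := g.2
      exact totalSubgraph_disjoint (fun _ _ h => h.elim) (by grind) (by grind)

end Constructions

/-! ### The lower bound: counting members in each case -/

section LowerBound

lemma ncard_pair_le {α : Type*} (a b : α) : ({a, b} : Set α).ncard ≤ 2 :=
  (Set.ncard_insert_le a {b}).trans (by simp)

variable {V : Type*} {G : SimpleGraph V}

lemma exists_mem_notMem {e f : G.edgeSet} (hef : e ≠ f) :
    ∃ x ∈ (e : Sym2 V), x ∉ (f : Sym2 V) := by
  by_contra! h
  obtain ⟨x, hx⟩ : ∃ x, x ∈ (e : Sym2 V) := ⟨_, Sym2.out_fst_mem _⟩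
  obtain ⟨y, hy, -, he⟩ := exists_other_end e hx
  have hye : y ∈ (e : Sym2 V) := he ▸ Sym2.mem_mk_right _ _
  exact hef (edgeSet_ext hy hye hx (h y hye) (h x hx))

lemma IsPacking.exists_notMem {n : ℕ} (hn : 2 ≤ n) {S : Set V} {T : Fin n → SimpleGraph V}
    (hT : IsPacking G S T) (e : Sym2 V) : ∃ k, e ∉ (T k).edgeSet := by
  by_contra! h
  have := hT.eq_of_mem_edgeSet (h ⟨0, by omega⟩) (h ⟨1, by omega⟩)
  simp at this

/-- Each of `e` and `f` lies in at most one of the members, of which there are at least three. -/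
lemma IsPacking.exists_notMem_notMem {n : ℕ} (hn : 3 ≤ n) {S : Set V} {T : Fin n → SimpleGraph V}
    (hT : IsPacking G S T) (e f : Sym2 V) : ∃ k, e ∉ (T k).edgeSet ∧ f ∉ (T k).edgeSet := by
  by_contra! h
  have h' : ∀ k, e ∈ (T k).edgeSet ∨ f ∈ (T k).edgeSet := fun k => or_iff_not_imp_left.2 (h k)
  rcases h' ⟨0, by omega⟩ with h0 | h0 <;> rcases h' ⟨1, by omega⟩ with h1 | h1 <;>
    rcases h' ⟨2, by omega⟩ with h2 | h2 <;>
    first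
    | simpa using hT.eq_of_mem_edgeSet h0 h1
    | simpa using hT.eq_of_mem_edgeSet h0 h2
    | simpa using hT.eq_of_mem_edgeSet h1 h2

/-- The triple in `G` is `x`, `y` and the other end `w` of `e`. If `2 ≤ m`, some tree avoids `e`,
and its edge at `w` is the detour to `e`; if `m = 1`, no detour is needed as `t ≤ 2`. -/
lemma hasEdgeDisjointSteinerTrees_of_one_incident {t m : ℕ}
    (hm : ∀ S : Finset V, S.card = 3 → ∃ K : Fin m → SimpleGraph V, IsPacking G S K)
    (htm : t ≤ 2 * m) (htm' : t ≤ m + 2) {x y : V} {e : G.edgeSet} (hxy : x ≠ y)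
    (hx : x ∈ (e : Sym2 V)) (hy : y ∉ (e : Sym2 V)) (h0 : 0 < t) :
    G.totalGraph.HasEdgeDisjointSteinerTrees {Sum.inl x, Sum.inl y, Sum.inr e} t := by
  classical
  obtain ⟨w, hwx, -, he⟩ := exists_other_end e hx
  have hwe : w ∈ (e : Sym2 V) := he ▸ Sym2.mem_mk_right _ _
  have hwy : w ≠ y := by
    rintro rfl
    exact hy hwe
  obtain ⟨T, hT⟩ := hm {x, y, w} (Finset.card_eq_three.2 ⟨_, _, _, hxy, hwx.symm, hwy.symm, rfl⟩)
  have hS : (({x, y, w} : Finset V) : Set V).Nontrivial := ⟨x, by simp, y, by simp, hxy⟩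
  obtain ⟨q, hq'⟩ := hT.exists_edges hS fun _ => True
  have hq := fun x hx j => And.intro (hq' x hx j).1 (hq' x hx j).2.1
  have key := exists_isPacking_of_incident hT hS (U := {x, y}) (D := ∅) (c := fun _ => x)
    (by simp [Set.insert_subset_iff]) (by simp) (by simp) (by simp) (u := x) (w := w) (by simp)
    (by simp) (by simp [hwx, hwy]) he hq
  have hset : (Sum.inl '' {x, y} ∪ Sum.inr '' (insert e ∅) : Set (V ⊕ G.edgeSet)) =
      {Sum.inl x, Sum.inl y, Sum.inr e} := by
    ext
    simp
    tauto
  rw [hset] at key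
  by_cases hm2 : 2 ≤ m
  · obtain ⟨k, hk⟩ := hT.exists_notMem hm2 e
    have hqk := hq w (by simp) k
    have hne : q w k ≠ e := fun h => hk (h ▸ hqk.1)
    obtain ⟨K, hK⟩ := (key ⟨0, by omega⟩ ⟨1, by omega⟩).2 (by simp)
      ⟨w, by simp, q w k, hqk.2, ⟨w, hqk.2, hwe⟩, by simp [hwx, hwy], by simp, fun _ => hne,
        fun _ j => ⟨fun h => hk (hT.eq_of_mem_edgeSet hqk.1 h.1 ▸ h.2), fun h => hne
          (edgeSet_ext hwx hqk.2 (h ▸ (hq x (by simp) j).2) hwe hx)⟩⟩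
    exact hK.hasEdgeDisjointSteinerTrees (by simp; omega)
  · obtain ⟨K, hK⟩ := (key ⟨0, by omega⟩ ⟨0, by omega⟩).1
    exact hK.hasEdgeDisjointSteinerTrees (by simp; omega)

lemma hasEdgeDisjointSteinerTrees_of_both_ends {t n : ℕ}
    (hn : ∀ x y : V, x ≠ y → ∃ K : Fin n → SimpleGraph V, IsPacking G {x, y} K)
    (htn : t ≤ 2 * n - 1) {x y : V} {e : G.edgeSet} (hxy : x ≠ y)
    (hx : x ∈ (e : Sym2 V)) (hy : y ∈ (e : Sym2 V)) (h0 : 0 < t) :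
    G.totalGraph.HasEdgeDisjointSteinerTrees {Sum.inl x, Sum.inl y, Sum.inr e} t := by
  classical
  obtain ⟨T, hT⟩ := hn x y hxy
  let ι := {j // (e : Sym2 V) ∉ (T j).edgeSet}
  -- At most one member contains `e`; it is sent to `none`.
  have hι : n ≤ Nat.card ι + 1 := by
    rw [← Finite.card_option, ← Nat.card_fin n]
    refine Nat.card_le_card_of_injective
      (fun j => if h : (e : Sym2 V) ∈ (T j).edgeSet then none else some (⟨j, h⟩ : ι)) ?_
    intro i j hij
    by_cases hi : (e : Sym2 V) ∈ (T i).edgeSet <;> by_cases hj : (e : Sym2 V) ∈ (T j).edgeSet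
    · exact hT.eq_of_mem_edgeSet hi hj
    · simp [hi, hj] at hij
    · simp [hi, hj] at hij
    · simp only [hi, hj, dite_false, Option.some.injEq] at hij
      exact congrArg Subtype.val hij
  obtain ⟨K, hK⟩ := exists_isPacking_of_both_ends (hT.comp (Function.Embedding.subtype _)) e
    ((Sym2.mem_and_mem_iff hxy).1 ⟨hx, hy⟩) fun j : ι => j.2
  have hset : (Sum.inl '' {x, y} ∪ Sum.inr '' {e} : Set (V ⊕ G.edgeSet)) =
      {Sum.inl x, Sum.inl y, Sum.inr e} := by
    ext
    simp
    tauto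
  rw [hset] at hK
  exact hK.hasEdgeDisjointSteinerTrees (by
    rw [Finite.card_option, Nat.card_sum]
    change t ≤ Nat.card ι + Nat.card ι + 1
    omega)

variable [Fintype V] {t m n : ℕ}
  (hm : ∀ S : Finset V, S.card = 3 → ∃ K : Fin m → SimpleGraph V, IsPacking G S K)
  (hn : ∀ x y : V, x ≠ y → ∃ K : Fin n → SimpleGraph V, IsPacking G {x, y} K)
  (hV : 3 ≤ Fintype.card V) (h0 : 0 < t) (htm : t ≤ 2 * m) (htm' : t ≤ m + 2)
  (htn : t ≤ 2 * n - 1)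

include hV in
lemma exists_card_eq_three_superset (S : Finset V) (hS : S.card ≤ 3) :
    ∃ S' : Finset V, S ⊆ S' ∧ S'.card = 3 := by
  obtain ⟨S', h, -, h'⟩ := Finset.exists_subsuperset_card_eq (Finset.subset_univ S) hS
    (by simpa using hV)
  exact ⟨S', h, h'⟩

include hm hV in
lemma le_ncard_edges (x : V) : m ≤ {e : G.edgeSet | x ∈ (e : Sym2 V)}.ncard := by
  obtain ⟨S, hxS, hS⟩ := exists_card_eq_three_superset hV {x} (by simp)
  have hx : x ∈ S := hxS (by simp)
  obtain ⟨y, hy, hyx⟩ := Finset.exists_mem_ne (s := S) (by omega) x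
  obtain ⟨K, hK⟩ := hm S hS
  simpa using hK.card_le_ncard_edges hx hy hyx.symm

include hn in
lemma le_ncard_edges' {x y : V} (hxy : x ≠ y) : n ≤ {e : G.edgeSet | x ∈ (e : Sym2 V)}.ncard := by
  obtain ⟨K, hK⟩ := hn x y hxy
  simpa using hK.card_le_ncard_edges (by simp) (y := y) (by simp) hxy

include hm hV h0 htm htm' in
lemma hasEdgeDisjointSteinerTrees_of_not_incident {U : Finset V} {D : Finset G.edgeSet}
    (hUD3 : U.card + D.card = 3) {c : G.edgeSet → V} (hc : ∀ e ∈ D, c e ∈ (e : Sym2 V))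
    (hinj : Set.InjOn c D) (hUD : ∀ u ∈ U, ∀ e ∈ D, u ∉ (e : Sym2 V)) :
    G.totalGraph.HasEdgeDisjointSteinerTrees (Sum.inl '' U ∪ Sum.inr '' D) t := by
  classical
  obtain ⟨S, hS, hS3⟩ := exists_card_eq_three_superset hV (U ∪ D.image c)
    ((Finset.card_union_le _ _).trans (by have := Finset.card_image_le (s := D) (f := c); omega))
  obtain ⟨T, hT⟩ := hm S hS3
  have key := exists_isPacking_of_not_incident hT
    (Finset.one_lt_card_iff_nontrivial.1 (by omega)) (U := U) (D := D)
    (fun x hx => hS (Finset.mem_union_left _ hx)) (c := c)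
    (fun e he => ⟨hS (Finset.mem_union_right _ (Finset.mem_image_of_mem _ he)), hc e he⟩) hinj hUD
  by_cases hm2 : 2 ≤ m
  · obtain ⟨K, hK⟩ := (key ⟨0, by omega⟩ ⟨1, by omega⟩).2 (by simp)
    exact hK.hasEdgeDisjointSteinerTrees (by simp; omega)
  · obtain ⟨K, hK⟩ := (key ⟨0, by omega⟩ ⟨0, by omega⟩).1
    exact hK.hasEdgeDisjointSteinerTrees (by simp; omega)

include hm hV h0 htm htm' in
lemma hasEdgeDisjointSteinerTrees_edges {e₁ e₂ e₃ : G.edgeSet} (h12 : e₁ ≠ e₂) (h13 : e₁ ≠ e₃)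
    (h23 : e₂ ≠ e₃) :
    G.totalGraph.HasEdgeDisjointSteinerTrees {Sum.inr e₁, Sum.inr e₂, Sum.inr e₃} t := by
  classical
  -- The cyclic choice (each end lies off the next edge) makes the three representatives distinct.
  obtain ⟨x, hx, hx'⟩ := exists_mem_notMem h12
  obtain ⟨y, hy, hy'⟩ := exists_mem_notMem h23
  obtain ⟨z, hz, hz'⟩ := exists_mem_notMem h13.symm
  have := hasEdgeDisjointSteinerTrees_of_not_incident hm hV h0 htm htm' (U := ∅)
    (D := {e₁, e₂, e₃}) (by rw [Finset.card_empty, Finset.card_eq_three.2 ⟨_, _, _, h12, h13, h23, rfl⟩])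
    (c := fun e => if e = e₁ then x else if e = e₂ then y else z) (by grind)
    (by intro a ha b hb; simp at ha hb; grind) (by simp)
  convert this using 1
  simp [Set.image_insert_eq]

include hm hV h0 htm htm' in
lemma hasEdgeDisjointSteinerTrees_vertices {x y z : V} (hxy : x ≠ y) (hxz : x ≠ z)
    (hyz : y ≠ z) :
    G.totalGraph.HasEdgeDisjointSteinerTrees {Sum.inl x, Sum.inl y, Sum.inl z} t := by
  classical
  have := hasEdgeDisjointSteinerTrees_of_not_incident (G := G) hm hV h0 htm htm' (U := {x, y, z})
    (D := ∅) (by rw [Finset.card_empty, Finset.card_eq_three.2 ⟨_, _, _, hxy, hxz, hyz, rfl⟩])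
    (c := fun _ => x) (by simp) (by simp) (by simp)
  convert this using 1
  simp [Set.image_insert_eq]

include hm hn hV h0 htm htm' htn in
lemma hasEdgeDisjointSteinerTrees_vertices_edge {x y : V} (hxy : x ≠ y) (e : G.edgeSet) :
    G.totalGraph.HasEdgeDisjointSteinerTrees {Sum.inl x, Sum.inl y, Sum.inr e} t := by
  classical
  by_cases hx : x ∈ (e : Sym2 V) <;> by_cases hy : y ∈ (e : Sym2 V)
  · exact hasEdgeDisjointSteinerTrees_of_both_ends hn htn hxy hx hy h0
  · exact hasEdgeDisjointSteinerTrees_of_one_incident hm htm htm' hxy hx hy h0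
  · rw [Set.insert_comm]
    exact hasEdgeDisjointSteinerTrees_of_one_incident hm htm htm' hxy.symm hy hx h0
  · obtain ⟨z, hz⟩ : ∃ z, z ∈ (e : Sym2 V) := ⟨_, Sym2.out_fst_mem _⟩
    have := hasEdgeDisjointSteinerTrees_of_not_incident hm hV h0 htm htm' (U := {x, y})
      (D := {e}) (by simp [Finset.card_pair hxy]) (c := fun _ => z) (by simpa) (by simp)
      (by simp [hx, hy])
    convert this using 1
    ext
    simp
    tauto

-- If `3 ≤ m`, some tree avoids `e` and `f`, and its edge at the other end of `e` is the detour. The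
-- delicate case is `m = 2`, `t = 4`, where the detour starts at `u` and the degree bound from λ(G)
-- is needed.
include hm hn hV h0 htm htm' htn in
lemma hasEdgeDisjointSteinerTrees_of_one_incident' {u : V} {e f : G.edgeSet}
    (hue : u ∈ (e : Sym2 V)) (huf : u ∉ (f : Sym2 V)) :
    G.totalGraph.HasEdgeDisjointSteinerTrees {Sum.inl u, Sum.inr e, Sum.inr f} t := by
  classical
  obtain ⟨w, hwu, -, he⟩ := exists_other_end e hue
  have hwe : w ∈ (e : Sym2 V) := he ▸ Sym2.mem_mk_right _ _
  obtain ⟨v, hv⟩ : ∃ v, v ∈ (f : Sym2 V) := ⟨_, Sym2.out_fst_mem _⟩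
  obtain ⟨S, hS', hS3⟩ := exists_card_eq_three_superset hV {u, w, v} Finset.card_le_three
  obtain ⟨T, hT⟩ := hm S hS3
  have huS : u ∈ S := hS' (by simp)
  have hwS : w ∈ S := hS' (by simp)
  have hvS : v ∈ S := hS' (by simp)
  have hS : (S : Set V).Nontrivial := ⟨u, huS, w, hwS, hwu.symm⟩
  -- Avoiding `e` whenever possible ensures that `q u j = e` only if `e` is the sole edge of `T j`
  -- at `u`.
  obtain ⟨q, hq'⟩ := hT.exists_edges hS fun g => g ≠ e
  have hq := fun x hx j => And.intro (hq' x hx j).1 (hq' x hx j).2.1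
  have key := exists_isPacking_of_incident hT hS (U := {u}) (D := {f}) (c := fun _ => v)
    (by simpa) (by simp [hv, hvS]) (by simp) (by simpa) (u := u) (w := w) (by simp)
    hwS (by simpa) he hq
  have hset : (Sum.inl '' {u} ∪ Sum.inr '' (insert e {f}) : Set (V ⊕ G.edgeSet)) =
      {Sum.inl u, Sum.inr e, Sum.inr f} := by
    ext
    simp
    tauto
  rw [hset] at key
  have hef : e ≠ f := by
    rintro rfl
    exact huf hue
  by_cases hm3 : 3 ≤ m
  · obtain ⟨k, hk, hk'⟩ := hT.exists_notMem_notMem hm3 e f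
    have hqk := hq w hwS k
    have hne : q w k ≠ e := fun h => hk (h ▸ hqk.1)
    obtain ⟨K, hK⟩ := (key ⟨0, by omega⟩ ⟨1, by omega⟩).2 (by simp)
      ⟨w, hwS, q w k, hqk.2, ⟨w, hqk.2, hwe⟩, fun h => absurd h hwu,
        fun h => hk' (h ▸ hqk.1), fun _ => hne,
        fun _ j => ⟨fun h => hk (hT.eq_of_mem_edgeSet hqk.1 h.1 ▸ h.2), fun h => hne
          (edgeSet_ext hwu hqk.2 (h ▸ (hq u huS j).2) hwe hue)⟩⟩
    exact hK.hasEdgeDisjointSteinerTrees (by simp; omega)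
  by_cases hm2 : t ≤ m + 1
  · obtain ⟨K, hK⟩ := (key ⟨0, by omega⟩ ⟨0, by omega⟩).1
    exact hK.hasEdgeDisjointSteinerTrees (by simp; omega)
  -- Here `t = 4`, so `htn` gives `3 ≤ n`, and `u` has an edge besides `q u 0` and `q u 1`.
  obtain rfl : m = 2 := by omega
  refine Exists.elim ((key 0 1).2 (by simp) ?_) fun K hK =>
    hK.hasEdgeDisjointSteinerTrees (by simp; omega)
  by_cases hqe : ∀ j, q u j ≠ e
  · exact ⟨u, huS, e, hue, ⟨u, hue, hue⟩, fun _ j => (hqe j).symm, hef,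
      fun h => absurd h.symm hwu, fun h => absurd rfl h⟩
  · push Not at hqe
    obtain ⟨j₀, hj₀⟩ := hqe
    have h3 : 3 ≤ {g : G.edgeSet | u ∈ (g : Sym2 V)}.ncard :=
      le_trans (by omega) (le_ncard_edges' hn hwu.symm)
    obtain ⟨g, hg, hg'⟩ := Set.exists_mem_notMem_of_ncard_lt_ncard
      (s := {q u 0, q u 1}) (lt_of_le_of_lt (ncard_pair_le _ _) h3)
    have hgq : ∀ j, g ≠ q u j := by
      rintro j rfl
      fin_cases j <;> simp at hg'
    refine ⟨u, huS, g, hg, ⟨u, hg, hue⟩, fun _ => hgq, fun h => huf (h ▸ hg),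
      fun h => absurd h.symm hwu, fun _ j => ⟨fun h => ?_, hgq j⟩⟩
    have hj : j = j₀ := hT.eq_of_mem_edgeSet h.2 (hj₀ ▸ (hq u huS j₀).1)
    subst hj
    exact (hq' u huS j).2.2 ⟨g, h.1, hg, fun h' => hgq j (h'.trans hj₀.symm)⟩ hj₀

-- With d edges at `u`, the stars and the path give d - 1 members, and one, two or three copies of
-- trees are added for `m = 1`, `m = 2`, `3 ≤ m`. For `3 ≤ m` the bound d ≥ `m` suffices; for
-- smaller `m`, d ≥ `n` and `htn` are needed too.
include hm hn hV h0 htm htm' htn in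
lemma hasEdgeDisjointSteinerTrees_of_two_incident {u : V} {e f : G.edgeSet} (hef : e ≠ f)
    (hue : u ∈ (e : Sym2 V)) (huf : u ∈ (f : Sym2 V)) :
    G.totalGraph.HasEdgeDisjointSteinerTrees {Sum.inl u, Sum.inr e, Sum.inr f} t := by
  classical
  obtain ⟨w₁, hwu₁, -, he⟩ := exists_other_end e hue
  obtain ⟨w₂, hwu₂, -, hf⟩ := exists_other_end f huf
  have hww : w₁ ≠ w₂ := by
    rintro rfl
    exact hef (Subtype.ext (he.trans hf.symm))
  obtain ⟨T, hT⟩ := hm {u, w₁, w₂}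
    (Finset.card_eq_three.2 ⟨_, _, _, hwu₁.symm, hwu₂.symm, hww, rfl⟩)
  have key := exists_isPacking_of_two_incident hT (by simp) (by simp) (by simp) he hf hef
  have hset : (Sum.inl '' {u} ∪ Sum.inr '' {e, f} : Set (V ⊕ G.edgeSet)) =
      {Sum.inl u, Sum.inr e, Sum.inr f} := by
    ext
    simp
    tauto
  rw [hset] at key
  have hN : {g : G.edgeSet | u ∈ (g : Sym2 V)}.ncard ≤
      Nat.card {g : G.edgeSet // u ∈ (g : Sym2 V) ∧ g ≠ e ∧ g ≠ f} + 2 := by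
    have h1 : {g : G.edgeSet | u ∈ (g : Sym2 V)} ⊆
        {g : G.edgeSet | u ∈ (g : Sym2 V) ∧ g ≠ e ∧ g ≠ f} ∪ {e, f} := by
      intro g hg
      simp at hg ⊢
      tauto
    exact (Set.ncard_le_ncard h1).trans ((Set.ncard_union_le _ _).trans
      (Nat.add_le_add_left (ncard_pair_le _ _) _))
  have hd := le_ncard_edges hm hV
  have hdu := hd u
  have hdu' := le_ncard_edges' hn hwu₁.symm
  have hex : ∀ w (s : Set G.edgeSet), s.ncard < m → ∃ h : G.edgeSet, w ∈ (h : Sym2 V) ∧ h ∉ s :=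
    fun w s hs => Set.exists_mem_notMem_of_ncard_lt_ncard (hs.trans_le (hd w))
  by_cases hm2 : 2 ≤ m
  · obtain ⟨h₁, hh₁, hhe₁⟩ := hex w₁ {e} (by simp; omega)
    obtain ⟨h₂, hh₂, hhe₂⟩ := hex w₂ {f} (by simp; omega)
    by_cases hm3 : 3 ≤ m
    · obtain ⟨h₃, hh₃, hhe₃⟩ := hex w₁ {e, h₁} (lt_of_le_of_lt (ncard_pair_le _ _) hm3)
      simp only [Set.mem_insert_iff, Set.mem_singleton_iff, not_or] at hhe₃
      obtain ⟨K, hK⟩ := ((key ⟨0, by omega⟩ ⟨1, by omega⟩ ⟨2, by omega⟩).2 (by simp)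
        h₁ h₂ hh₁ hhe₁ hh₂ hhe₂).2 (by simp) (by simp) h₃ hh₃ hhe₃.1 hhe₃.2
      exact hK.hasEdgeDisjointSteinerTrees (by simp only [Finite.card_option]; omega)
    · obtain ⟨K, hK⟩ := ((key ⟨0, by omega⟩ ⟨1, by omega⟩ ⟨0, by omega⟩).2 (by simp)
        h₁ h₂ hh₁ hhe₁ hh₂ hhe₂).1
      exact hK.hasEdgeDisjointSteinerTrees (by simp only [Finite.card_option]; omega)
  · obtain ⟨K, hK⟩ := (key ⟨0, by omega⟩ ⟨0, by omega⟩ ⟨0, by omega⟩).1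
    exact hK.hasEdgeDisjointSteinerTrees (by simp only [Finite.card_option]; omega)

include hm hn hV h0 htm htm' htn in
lemma hasEdgeDisjointSteinerTrees_vertex_edges (u : V) {e f : G.edgeSet} (hef : e ≠ f) :
    G.totalGraph.HasEdgeDisjointSteinerTrees {Sum.inl u, Sum.inr e, Sum.inr f} t := by
  classical
  by_cases hue : u ∈ (e : Sym2 V) <;> by_cases huf : u ∈ (f : Sym2 V)
  · exact hasEdgeDisjointSteinerTrees_of_two_incident hm hn hV h0 htm htm' htn hef hue huf
  · exact hasEdgeDisjointSteinerTrees_of_one_incident' hm hn hV h0 htm htm' htn hue huf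
  · rw [Set.pair_comm]
    exact hasEdgeDisjointSteinerTrees_of_one_incident' hm hn hV h0 htm htm' htn huf hue
  · obtain ⟨x, hx, hx'⟩ := exists_mem_notMem hef
    obtain ⟨y, hy, hy'⟩ := exists_mem_notMem hef.symm
    have := hasEdgeDisjointSteinerTrees_of_not_incident hm hV h0 htm htm' (U := {u})
      (D := {e, f}) (by simp [Finset.card_pair hef]) (c := fun g => if g = e then x else y)
      (by grind) (by intro a ha b hb; simp at ha hb; grind) (by simp [hue, huf])
    convert this using 1
    ext
    simp
    tauto

include hm hn hV htm htm' htn in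
lemma hasEdgeDisjointSteinerTrees_totalGraph {S : Finset (V ⊕ G.edgeSet)} (hS : S.card = 3) :
    G.totalGraph.HasEdgeDisjointSteinerTrees S t := by
  classical
  rcases Nat.eq_zero_or_pos t with rfl | h0
  · exact ⟨fun i => i.elim0, fun i => i.elim0, fun i => i.elim0⟩
  have hVVE := @hasEdgeDisjointSteinerTrees_vertices_edge V G _ t m n hm hn hV h0 htm htm' htn
  have hVEE := @hasEdgeDisjointSteinerTrees_vertex_edges V G _ t m n hm hn hV h0 htm htm' htn
  obtain ⟨a, b, c, hab, hac, hbc, rfl⟩ := Finset.card_eq_three.1 hS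
  have e1 : ({a, b, c} : Set (V ⊕ G.edgeSet)) = {a, c, b} := by grind
  have e2 : ({a, b, c} : Set (V ⊕ G.edgeSet)) = {b, c, a} := by grind
  have e3 : ({a, b, c} : Set (V ⊕ G.edgeSet)) = {b, a, c} := by grind
  have e4 : ({a, b, c} : Set (V ⊕ G.edgeSet)) = {c, a, b} := by grind
  push_cast
  rcases a with a | a <;> rcases b with b | b <;> rcases c with c | c
  · exact hasEdgeDisjointSteinerTrees_vertices hm hV h0 htm htm' (ne_of_apply_ne _ hab)
      (ne_of_apply_ne _ hac) (ne_of_apply_ne _ hbc)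
  · exact hVVE (ne_of_apply_ne _ hab) c
  · rw [e1]
    exact hVVE (ne_of_apply_ne _ hac) b
  · exact hVEE a (ne_of_apply_ne _ hbc)
  · rw [e2]
    exact hVVE (ne_of_apply_ne _ hbc) a
  · rw [e3]
    exact hVEE b (ne_of_apply_ne _ hac)
  · rw [e4]
    exact hVEE c (ne_of_apply_ne _ hab)
  · exact hasEdgeDisjointSteinerTrees_edges hm hV h0 htm htm' (ne_of_apply_ne _ hab)
      (ne_of_apply_ne _ hac) (ne_of_apply_ne _ hbc)

end LowerBound

/-! ### The upper bound, and the theorem -/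

/-- The degree of a vertex in the total graph is at most twice its degree. -/
lemma ncard_neighborSet_totalGraph_le {V : Type*} [Fintype V] (G : SimpleGraph V)
    [DecidableRel G.Adj] (v : V) :
    (G.totalGraph.neighborSet (Sum.inl v)).ncard ≤ 2 * G.degree v := by
  classical
  have h1 : G.totalGraph.neighborSet (Sum.inl v) =
      Sum.inl '' G.neighborSet v ∪ Sum.inr '' {e : G.edgeSet | v ∈ (e : Sym2 V)} := by
    ext (x | e)
    · simp [totalGraph]
    · simp [totalGraph]
  have h2 : (G.neighborSet v).ncard = G.degree v := by
    rw [Set.ncard_eq_toFinset_card', ← neighborFinset_def, card_neighborFinset_eq_degree]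
  have h3 : {e : G.edgeSet | v ∈ (e : Sym2 V)}.ncard ≤ G.degree v := by
    rw [← card_incidenceSet_eq_degree, ← Nat.card_eq_fintype_card]
    exact Nat.card_le_card_of_injective (β := G.incidenceSet v)
      (fun e : {e : G.edgeSet | v ∈ (e : Sym2 V)} => ⟨e.1, e.1.2, e.2⟩)
      fun e f hef => Subtype.ext (Subtype.ext (congrArg (fun x : G.incidenceSet v => (x : Sym2 V)) hef))
  rw [h1]
  refine (Set.ncard_union_le _ _).trans ?_
  rw [Set.ncard_image_of_injective _ Sum.inl_injective,
    Set.ncard_image_of_injective _ Sum.inr_injective]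
  omega

end SimpleGraph

open SimpleGraph in
theorem theorem4p5 {V : Type*} [Fintype V] (G : SimpleGraph V) [DecidableRel G.Adj]
    (hG : G.Connected) (hV : 2 ≤ Fintype.card V) :
    (3 ≤ Fintype.card V →
      min (2 * (G.edgeConnectivity : ℤ) - 1)
          (min (2 * (G.generalizedEdgeConnectivity 3 : ℤ))
            ((G.generalizedEdgeConnectivity 3 : ℤ) + 2))
        ≤ (G.totalGraph.generalizedEdgeConnectivity 3 : ℤ)) ∧
    G.totalGraph.generalizedEdgeConnectivity 3 ≤ 2 * G.minDegree := by
  classical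
  refine ⟨fun hV3 => ?_, ?_⟩
  · have key : min (2 * G.edgeConnectivity - 1) (min (2 * G.generalizedEdgeConnectivity 3)
        (G.generalizedEdgeConnectivity 3 + 2)) ≤ G.totalGraph.generalizedEdgeConnectivity 3 :=
      le_generalizedEdgeConnectivity (by norm_num)
        (by rw [Fintype.card_sum]; omega) fun S hS =>
        hasEdgeDisjointSteinerTrees_totalGraph
          (fun S hS => exists_isPacking_generalizedEdgeConnectivity G (by norm_num) hS)
          (fun x y hxy => exists_isPacking_edgeConnectivity G hxy) hV3
          (by omega) (by omega) (by omega) hS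
    omega
  · have : Nontrivial V := Fintype.one_lt_card_iff_nontrivial.1 hV
    obtain ⟨v, hv⟩ := G.exists_minimal_degree_vertex
    obtain ⟨y, hy⟩ := hG.preconnected.exists_adj_of_nontrivial v
    let S : Finset (V ⊕ G.edgeSet) :=
      {Sum.inl v, Sum.inl y, Sum.inr ⟨s(v, y), hy⟩}
    have hS : S.card = 3 := Finset.card_eq_three.2
      ⟨_, _, _, by simpa using hy.ne, by simp, by simp, rfl⟩
    obtain ⟨K, hK⟩ := exists_isPacking_generalizedEdgeConnectivity G.totalGraph (by norm_num) hS
    have := hK.card_le_ncard_neighborSet (x := Sum.inl v) (y := Sum.inl y) (by simp [S])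
      (by simp [S]) (by simpa using hy.ne)
    rw [hv]
    exact (by simpa using this : _ ≤ _).trans (ncard_neighborSet_totalGraph_le G v)
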